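/- **Setting.** Let $\mathbb G$ be a locally compact Polish group with Haar measure $m_{\mathbb G}$. A *non-singular endomorphism* is a standard probability space $(X,\mathcal B,m)$ with a measurable $T:X\to X$ such that $m(T^{-1}A)=0\Leftrightarrow m(A)=0$ for all $A\in\mathcal B$. It is *ergodic* if every set in $\mathcal I(T)=\{A\in\mathcal B: T^{-1}A=A\}$ is null or co-null, and *exact* if every set in $\mathcal T(T)=\bigcap_{n\ge0}T^{-n}\mathcal B$ is null or co-null. A *non-singular $\mathbb G$-action* on a standard probability space $(Y,\mathcal C,\nu)$ is a measurable homomorphism $S$ from $\mathbb G$ to the group of invertible non-singular transformations of $(Y,\nu)$ (modulo $\nu$-a.e. equality), given by a jointly measurable version $(g,y)\mapsto S_gy$. It is *ergodic* if every $A\in\mathcal C$ with $S_g^{-1}A=A$ $\nu$-a.e. for every $g$ is null or co-null. Two such actions are isomorphic ($\cong$) if there is an equivariant isomorphism modulo null sets which preserves the measure class; products of actions are diagonal, $(U\times S)_g(\omega,y)=(U_g\omega,S_gy)$. For a non-singular endomorphism $(X,\mathcal B,m,T)$ and a measurable $f:X\to\mathbb G$, let $T_f(x,g)=(Tx,f(x)g)$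 and $Q_t(x,g)=(x,gt^{-1})$ on $X\times\mathbb G$, and let $\mathbb P$ be a probability measure equivalent to $m\times m_{\mathbb G}$. The *invariant (Poisson) action* $\mathfrak p(T,f)$, respectively the *tail action* $\tau(T,f)$, is the non-singular $\mathbb G$-action $(\Omega,\mathcal F,P,U)$ for which there is a measurable $\pi:X\times\mathbb G\to\Omega$ with $\mathbb P\circ\pi^{-1}=P$, with $\pi^{-1}\mathcal F=\mathcal I(T_f)$ and $\pi\circ T_f=\pi$ (respectively with $\pi^{-1}\mathcal F=\mathcal T(T_f)$), and with $\pi\circ Q_t=U_t\circ\pi$ for every $t\in\mathbb G$; all modulo $\mathbb P$-null sets. On $X\times\mathbb G$, ergodicity and exactness of $T_f$ are defined as above, with respect to $m\times m_{\mathbb G}$ (equivalently $\mathbb P$). **Proposition 2.1 (with Corollary 2.2).** Let $(X,\mathcal B,m,T)$ be a non-singular endomorphism, $f:X\to\mathbb G$ measurable, and $S$ a non-singular $\mathbb G$-action on a standard probability space $(Y,\mathcal C,\nu)$. Let $\widetilde T(x,y)=(Tx,S_{f(x)}y)$ on $(X\times Y,m\times\nu)$, and regard $f$ also as a function on $X\times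 Y$ by $f(x,y)=f(x)$. Then $\widetilde T$ is a non-singular endomorphism, the associated actions $\mathfrak p(T,f)$, $\tau(T,f)$, $\mathfrak p(\widetilde T,f)$, $\tau(\widetilde T,f)$ exist, and $$\mathfrak p(\widetilde T,f)\cong\mathfrak p(T,f)\times S,\qquad \tau(\widetilde T,f)\cong\tau(T,f)\times S .$$ Moreover: 1. $\widetilde T$ is ergodic if and only if $\mathfrak p(T,f)\times S$ is ergodic. 2. $\widetilde T$ is exact if and only if $\tau(T,f)\times S$ is ergodic. 3. If $T_f$ and $S$ are ergodic, then $\widetilde T$ is ergodic and $\mathfrak p(\widetilde T,f)\cong S$. 4. If $T_f$ is exact and $S$ is ergodic, then $\widetilde T$ is exact and $\tau(\widetilde T,f)\cong S$. -/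

import Mathlib

open MeasureTheory Filter

/-- A measurable self-map `T` of `(X, μ)` is *non-singular* if `μ (T⁻¹ A) = 0 ↔ μ A = 0` for every
measurable set `A`. On a standard probability space these are the non-singular endomorphisms. -/
structure IsNonsingular {X : Type*} [MeasurableSpace X] (T : X → X) (μ : Measure X) : Prop where
  measurable : Measurable T
  null_iff : ∀ A : Set X, MeasurableSet A → (μ (T ⁻¹' A) = 0 ↔ μ A = 0)

/-- The tail `σ`-algebra `⋂ₙ T⁻ⁿ 𝓑` of a map `T`.
(The invariant `σ`-algebra `{A ∈ 𝓑 : T⁻¹ A = A}` is `MeasurableSpace.invariants T`.) -/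
@[reducible]
def tailAlgebra {X : Type*} [mX : MeasurableSpace X] (T : X → X) : MeasurableSpace X :=
  ⨅ n : ℕ, mX.comap (T^[n])

/-- Exactness: every tail set is null or co-null. -/
def IsExact {X : Type*} [MeasurableSpace X] (T : X → X) (μ : Measure X) : Prop :=
  ∀ A : Set X, MeasurableSet[tailAlgebra T] A → μ A = 0 ∨ μ Aᶜ = 0

/-- Two `σ`-algebras consist of the same sets modulo `μ`-null sets. -/
def SameModNull {Z : Type*} [MeasurableSpace Z] (μ : Measure Z) (m₁ m₂ : MeasurableSpace Z) :
    Prop :=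
  (∀ A : Set Z, MeasurableSet[m₁] A → ∃ B : Set Z, MeasurableSet[m₂] B ∧ A =ᵐ[μ] B) ∧
  (∀ B : Set Z, MeasurableSet[m₂] B → ∃ A : Set Z, MeasurableSet[m₁] A ∧ A =ᵐ[μ] B)

universe u v w uG uX uY uA uB

/-- A *non-singular `G`-action* on a standard probability space `(Ω, μ)`: a measurable homomorphism
from `G` to the group of invertible non-singular transformations of `(Ω, μ)`, two of which are
identified if they agree `μ`-almost everywhere. It is given by a jointly measurable version
`(g, ω) ↦ act g ω`; the group law holds almost everywhere, for each pair of group elements, and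
it makes each `act g` invertible modulo null sets, with inverse `act g⁻¹`. Every measurable (Borel)
action by non-singular maps is an example. -/
structure NSAction (G : Type u) [Group G] [MeasurableSpace G] where
  Ω : Type v
  [mΩ : MeasurableSpace Ω]
  [std : StandardBorelSpace Ω]
  μ : Measure Ω
  [prob : IsProbabilityMeasure μ]
  act : G → Ω → Ω
  measurable_act : Measurable fun p : G × Ω => act p.1 p.2
  nonsingular : ∀ g : G, IsNonsingular (act g) μ
  act_one : act 1 =ᵐ[μ] id
  act_mul : ∀ g h : G, act (g * h) =ᵐ[μ] act g ∘ act h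

attribute [instance] NSAction.mΩ NSAction.std NSAction.prob

theorem IsNonsingular.quasiMeasurePreserving {X : Type*} [MeasurableSpace X] {T : X → X}
    {μ : Measure X} (h : IsNonsingular T μ) : Measure.QuasiMeasurePreserving T μ μ :=
  ⟨h.measurable, Measure.AbsolutelyContinuous.mk fun A hA h0 => by
    rw [Measure.map_apply h.measurable hA]; exact (h.null_iff A hA).2 h0⟩

theorem IsNonsingular.absolutelyContinuous_map {X : Type*} [MeasurableSpace X] {T : X → X}
    {μ : Measure X} (h : IsNonsingular T μ) : μ ≪ μ.map T :=
  Measure.AbsolutelyContinuous.mk fun A hA h0 => by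
    rw [Measure.map_apply h.measurable hA] at h0; exact (h.null_iff A hA).1 h0

theorem IsNonsingular.prodMap {X Y : Type*} [MeasurableSpace X] [MeasurableSpace Y]
    {T : X → X} {S : Y → Y} {μ : Measure X} {ν : Measure Y} [IsProbabilityMeasure μ]
    [IsProbabilityMeasure ν] (hT : IsNonsingular T μ) (hS : IsNonsingular S ν) :
    IsNonsingular (Prod.map T S) (μ.prod ν) := by
  have hm : Measurable (Prod.map T S) := hT.measurable.prodMap hS.measurable
  have : IsProbabilityMeasure (μ.map T) :=
    Measure.isProbabilityMeasure_map hT.measurable.aemeasurable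
  have : IsProbabilityMeasure (ν.map S) :=
    Measure.isProbabilityMeasure_map hS.measurable.aemeasurable
  have e : (μ.prod ν).map (Prod.map T S) = (μ.map T).prod (ν.map S) :=
    (Measure.map_prod_map μ ν hT.measurable hS.measurable).symm
  refine ⟨hm, fun A hA => ?_⟩
  rw [← Measure.map_apply hm hA, e]
  exact ⟨fun h => (hT.absolutelyContinuous_map.prod hS.absolutelyContinuous_map) h,
    fun h => (hT.quasiMeasurePreserving.absolutelyContinuous.prod
      hS.quasiMeasurePreserving.absolutelyContinuous) h⟩

theorem ae_prodMap_eq {X Y X' Y' : Type*} [MeasurableSpace X] [MeasurableSpace Y]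
    {μ : Measure X} {ν : Measure Y} [IsProbabilityMeasure μ] [IsProbabilityMeasure ν]
    {a a' : X → X'} {b b' : Y → Y'} (ha : a =ᵐ[μ] a') (hb : b =ᵐ[ν] b') :
    Prod.map a b =ᵐ[μ.prod ν] Prod.map a' b' := by
  filter_upwards [Measure.quasiMeasurePreserving_fst.ae ha,
    Measure.quasiMeasurePreserving_snd.ae hb] with z h1 h2
  exact Prod.ext h1 h2

namespace NSAction

variable {G : Type u} [Group G] [MeasurableSpace G]

/-- The (diagonal) product action `(A × B)_g (ω, y) = (A_g ω, B_g y)`. -/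
noncomputable def prod (A : NSAction.{u, v} G) (B : NSAction.{u, w} G) :
    NSAction.{u, max v w} G where
  Ω := A.Ω × B.Ω
  μ := A.μ.prod B.μ
  act g := Prod.map (A.act g) (B.act g)
  measurable_act :=
    (A.measurable_act.comp (measurable_fst.prodMk (measurable_fst.comp measurable_snd))).prodMk
      (B.measurable_act.comp (measurable_fst.prodMk (measurable_snd.comp measurable_snd)))
  nonsingular g := (A.nonsingular g).prodMap (B.nonsingular g)
  act_one := by simpa using ae_prodMap_eq A.act_one B.act_one
  act_mul g h := by simpa [Prod.map_comp_map] using ae_prodMap_eq (A.act_mul g h) (B.act_mul g h)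

/-- Ergodicity: every measurable set which is invariant (modulo null sets) under every group
element is null or co-null. -/
def IsErgodic (A : NSAction.{u, v} G) : Prop :=
  ∀ E : Set A.Ω, MeasurableSet E → (∀ g : G, A.act g ⁻¹' E =ᵐ[A.μ] E) → A.μ E = 0 ∨ A.μ Eᶜ = 0

/-- Isomorphism of non-singular actions: an equivariant isomorphism modulo null sets which
preserves the measure class. -/
def Isomorphic (A : NSAction.{u, v} G) (B : NSAction.{u, w} G) : Prop :=
  ∃ (φ : A.Ω → B.Ω) (ψ : B.Ω → A.Ω),
    Measure.QuasiMeasurePreserving φ A.μ B.μ ∧ Measure.QuasiMeasurePreserving ψ B.μ A.μ ∧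
    ψ ∘ φ =ᵐ[A.μ] id ∧ φ ∘ ψ =ᵐ[B.μ] id ∧
    ∀ g : G, φ ∘ A.act g =ᵐ[A.μ] B.act g ∘ φ

end NSAction

/-- The skew product `T_f (x, g) = (T x, f(x) g)` on `X × G`. -/
def skewProduct {X G : Type*} [Mul G] (T : X → X) (f : X → G) : X × G → X × G :=
  fun z => (T z.1, f z.1 * z.2)

/-- The map `Q_t (x, g) = (x, g t⁻¹)` on `X × G`. -/
def rightShift (X : Type*) {G : Type*} [Group G] (t : G) : X × G → X × G :=
  fun z => (z.1, z.2 * t⁻¹)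

/-- The Rokhlin endomorphism `(x, y) ↦ (T x, S_{f(x)} y)` on `X × Y`, `Y` the space of `S`. -/
def rokhlin {X : Type*} {G : Type u} [Group G] [MeasurableSpace G] (T : X → X) (f : X → G)
    (S : NSAction.{u, v} G) : X × S.Ω → X × S.Ω :=
  fun z => (T z.1, S.act (f z.1) z.2)

section Associated

variable {X : Type*} [MeasurableSpace X] {G : Type u} [Group G] [TopologicalSpace G]
  [IsTopologicalGroup G] [LocallyCompactSpace G] [MeasurableSpace G] [BorelSpace G]

/-- `A` is a factor of the maps `Q_t` on `(X × G, ℙ)`: `π` is a measurable map to the space of `A`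
with `ℙ ∘ π⁻¹ = A.μ` and, for every `t`, `π ∘ Q_t = A_t ∘ π` almost everywhere. -/
structure IsShiftFactor (ℙ : Measure (X × G)) (A : NSAction.{u, v} G) (π : X × G → A.Ω) :
    Prop where
  measurable : Measurable π
  map_eq : ℙ.map π = A.μ
  equivariant : ∀ t : G, π ∘ rightShift X t =ᵐ[ℙ] A.act t ∘ π

/-- `A` is (a realization of) the invariant, or Poisson, `G`-action `𝔭(T, f)`: the action induced
by `Q` on the invariant factor of `(X × G, ℙ, T_f)`, where `ℙ` is a probability measure equivalent
to `m × m_G`. -/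
def IsInvariantAction (m : Measure X) (T : X → X) (f : X → G) (A : NSAction.{u, v} G) : Prop :=
  ∃ (ℙ : Measure (X × G)) (π : X × G → A.Ω),
    IsProbabilityMeasure ℙ ∧ ℙ ≪ m.prod Measure.haar ∧ m.prod Measure.haar ≪ ℙ ∧
    IsShiftFactor ℙ A π ∧
    π ∘ skewProduct T f =ᵐ[ℙ] π ∧
    SameModNull ℙ (A.mΩ.comap π) (MeasurableSpace.invariants (skewProduct T f))

/-- `A` is (a realization of) the tail `G`-action `τ(T, f)`: the action induced by `Q` on the tail
factor of `(X × G, ℙ, T_f)`, where `ℙ` is a probability measure equivalent to `m × m_G`. -/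
def IsTailAction (m : Measure X) (T : X → X) (f : X → G) (A : NSAction.{u, v} G) : Prop :=
  ∃ (ℙ : Measure (X × G)) (π : X × G → A.Ω),
    IsProbabilityMeasure ℙ ∧ ℙ ≪ m.prod Measure.haar ∧ m.prod Measure.haar ≪ ℙ ∧
    IsShiftFactor ℙ A π ∧
    SameModNull ℙ (A.mΩ.comap π) (tailAlgebra (skewProduct T f))

end Associated

/-! The map `untwist`, `((x, y), g) ↦ ((x, g), S_{g⁻¹} y)`, is an isomorphism modulo null sets. It
carries the skew product over `T̃` to `T_f × id`, because `S_{(f(x)g)⁻¹} S_{f(x)} = S_{g⁻¹}`, and it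
carries `Q_t` to `Q_t × S_t`. A set invariant under `T_f × id`, or in its tail, has almost all of
its `y`-sections in the corresponding algebra of `T_f`. So the factor over `T̃` is the factor over
`T` times the space of `S`, with the diagonal action (`Realizes.prod_invariants`,
`Realizes.prod_tail`). Gluing sections measurably in `y` rests on `exists_measurable_joint_factor`.

Ergodicity and exactness of a base map are read off its associated action: a set invariant under
every `Q_t` is a cylinder `D × G` modulo null sets (`exists_ae_eq_preimage_fst`), and such a
cylinder is invariant or tail for the skew product exactly when `D` is so for the base, modulo null
sets. Applied to `T̃`, this gives both criteria. If `T_f` is ergodic or exact, its factor is a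
point, and a point times `S` is `S`. -/

theorem measurableSet_mem_iff_mem {X : Type*} [MeasurableSpace X] {A B : Set X}
    (hA : MeasurableSet A) (hB : MeasurableSet B) : MeasurableSet {x | x ∈ A ↔ x ∈ B} := by
  have : {x | x ∈ A ↔ x ∈ B} = (A ∩ B) ∪ (Aᶜ ∩ Bᶜ) := by ext; simp; tauto
  rw [this]
  exact (hA.inter hB).union (hA.compl.inter hB.compl)

open scoped Classical in
theorem measurable_decide_mem {X : Type*} [MeasurableSpace X] {A : Set X} (hA : MeasurableSet A) :
    Measurable fun x => decide (x ∈ A) := by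
  refine measurable_to_bool ?_
  convert hA using 1
  ext; simp

/-- A measurable map is *measure class preserving* if preimages of measurable sets are null exactly
when the sets are null. -/
structure ClassPreserving {X Y : Type*} [MeasurableSpace X] [MeasurableSpace Y] (T : X → Y)
    (μ : Measure X) (ν : Measure Y) : Prop where
  measurable : Measurable T
  null_iff : ∀ A : Set Y, MeasurableSet A → (μ (T ⁻¹' A) = 0 ↔ ν A = 0)

theorem IsNonsingular.classPreserving {X : Type*} [MeasurableSpace X] {T : X → X} {μ : Measure X}
    (h : IsNonsingular T μ) : ClassPreserving T μ μ := ⟨h.measurable, h.null_iff⟩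

theorem MeasureTheory.MeasurePreserving.classPreserving {X Y : Type*} [MeasurableSpace X]
    [MeasurableSpace Y] {T : X → Y} {μ : Measure X} {ν : Measure Y}
    (h : MeasurePreserving T μ ν) : ClassPreserving T μ ν :=
  ⟨h.measurable, fun _ hA => by rw [h.measure_preimage hA.nullMeasurableSet]⟩

/-! ### Calculus of maps preserving the measure class. -/

namespace ClassPreserving

variable {X Y Z : Type*} [MeasurableSpace X] [MeasurableSpace Y] [MeasurableSpace Z]
  {μ : Measure X} {ν : Measure Y} {ρ : Measure Z}

theorem isNonsingular {T : X → X} (h : ClassPreserving T μ μ) : IsNonsingular T μ :=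
  ⟨h.measurable, h.null_iff⟩

theorem id : ClassPreserving (id : X → X) μ μ := ⟨measurable_id, fun _ _ => Iff.rfl⟩

theorem comp {S : Y → Z} {T : X → Y} (hS : ClassPreserving S ν ρ) (hT : ClassPreserving T μ ν) :
    ClassPreserving (S ∘ T) μ ρ :=
  ⟨hS.measurable.comp hT.measurable, fun A hA => by
    rw [Set.preimage_comp, hT.null_iff _ (hS.measurable hA), hS.null_iff A hA]⟩

theorem iterate {T : X → X} (h : ClassPreserving T μ μ) (n : ℕ) : ClassPreserving T^[n] μ μ := by
  induction n with
  | zero => exact .id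
  | succ n ih => rw [Function.iterate_succ]; exact ih.comp h

theorem quasiMeasurePreserving {T : X → Y} (h : ClassPreserving T μ ν) :
    Measure.QuasiMeasurePreserving T μ ν :=
  ⟨h.measurable, Measure.AbsolutelyContinuous.mk fun A hA h0 => by
    rw [Measure.map_apply h.measurable hA]; exact (h.null_iff A hA).2 h0⟩

theorem ae_iff {T : X → Y} (h : ClassPreserving T μ ν) {p : Y → Prop}
    (hp : MeasurableSet {y | p y}) : (∀ᵐ x ∂μ, p (T x)) ↔ ∀ᵐ y ∂ν, p y :=
  h.null_iff _ hp.compl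

theorem preimage_ae_eq_iff {T : X → Y} (h : ClassPreserving T μ ν) {A B : Set Y}
    (hA : MeasurableSet A) (hB : MeasurableSet B) :
    T ⁻¹' A =ᵐ[μ] T ⁻¹' B ↔ A =ᵐ[ν] B := by
  rw [eventuallyEq_set, eventuallyEq_set]
  exact h.ae_iff (measurableSet_mem_iff_mem hA hB)

theorem comp_ae_eq_iff [StandardBorelSpace Z] {T : X → Y} (h : ClassPreserving T μ ν) {a b : Y → Z}
    (ha : Measurable a) (hb : Measurable b) : a ∘ T =ᵐ[μ] b ∘ T ↔ a =ᵐ[ν] b :=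
  h.ae_iff (p := fun y => a y = b y) (measurableSet_eq_fun ha hb)

theorem preimage_ae_eq {T : X → Y} (h : ClassPreserving T μ ν) {A B : Set Y} (e : A =ᵐ[ν] B) :
    T ⁻¹' A =ᵐ[μ] T ⁻¹' B :=
  h.quasiMeasurePreserving.preimage_ae_eq e

theorem comp_ae_eq {W : Type*} {T : X → Y} (h : ClassPreserving T μ ν) {a b : Y → W}
    (e : a =ᵐ[ν] b) : a ∘ T =ᵐ[μ] b ∘ T :=
  h.quasiMeasurePreserving.ae_eq_comp e

/-- Fibred maps over a class preserving map with class preserving fibre maps. -/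
theorem fibred {X' Y' : Type*} [MeasurableSpace X'] [MeasurableSpace Y'] {μ' : Measure X'}
    {ν' : Measure Y'} [SFinite ν] [SFinite ν'] {T : X → X'} (hT : ClassPreserving T μ μ')
    {F : X → Y → Y'} (hF : Measurable fun p : X × Y => F p.1 p.2)
    (h : ∀ x, ClassPreserving (F x) ν ν') :
    ClassPreserving (fun p : X × Y => (T p.1, F p.1 p.2)) (μ.prod ν) (μ'.prod ν') := by
  have hm : Measurable (fun p : X × Y => (T p.1, F p.1 p.2)) :=
    (hT.measurable.comp measurable_fst).prodMk hF
  refine ⟨hm, fun A hA => ?_⟩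
  rw [Measure.measure_prod_null (hm hA), Measure.measure_prod_null hA]
  -- By Fubini a set is null iff almost all its sections are; here nullity of the section over `x`
  -- depends only on `T x`.
  have e : ∀ x, ν (Prod.mk x ⁻¹' ((fun p : X × Y => (T p.1, F p.1 p.2)) ⁻¹' A)) = 0 ↔
      ν' (Prod.mk (T x) ⁻¹' A) = 0 := fun x =>
    (h x).null_iff (Prod.mk (T x) ⁻¹' A) (measurable_prodMk_left hA)
  refine Iff.trans ?_ (hT.ae_iff (p := fun x => ν' (Prod.mk x ⁻¹' A) = 0)
    (measurable_measure_prodMk_left hA (measurableSet_singleton 0)))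
  exact eventually_congr (Eventually.of_forall e)

end ClassPreserving

/-! ### Tail sets modulo null sets. -/

section Tail

variable {Z : Type*} [MeasurableSpace Z] {η : Measure Z} {R : Z → Z}

theorem measurableSet_tailAlgebra {A : Set Z} :
    MeasurableSet[tailAlgebra R] A ↔ ∀ n : ℕ, ∃ B, MeasurableSet B ∧ R^[n] ⁻¹' B = A := by
  simp only [MeasurableSpace.measurableSet_iInf, MeasurableSpace.measurableSet_comap]

theorem tailAlgebra_le : tailAlgebra R ≤ ‹MeasurableSpace Z› := fun A hA => by
  obtain ⟨B, hB, rfl⟩ := measurableSet_tailAlgebra.1 hA 0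
  exact hB

/-- A set which is in every `R⁻ⁿ 𝓑` modulo null sets is in the tail modulo null sets. -/
theorem exists_tail_ae_eq (hR : ClassPreserving R η η) {A : Set Z}
    (h : ∀ n : ℕ, ∃ B, MeasurableSet B ∧ A =ᵐ[η] R^[n] ⁻¹' B) :
    ∃ K, MeasurableSet[tailAlgebra R] K ∧ A =ᵐ[η] K := by
  choose B hB hAB using h
  -- The limsup of the sets `R⁻ⁿ Bₙ`, each almost everywhere equal to `A`. Dropping its first `k`
  -- terms changes nothing, so it is exactly the `R^k`-preimage of the limsup built from `B (n +
  -- k)`.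
  refine ⟨{z | ∃ᶠ n in atTop, R^[n] z ∈ B n}, ?_, ?_⟩
  · refine measurableSet_tailAlgebra.2 fun k =>
      ⟨{z | ∃ᶠ n in atTop, R^[n] z ∈ B (n + k)}, ?_, ?_⟩
    · have : {z | ∃ᶠ n in atTop, R^[n] z ∈ B (n + k)} =
          ⋂ a : ℕ, ⋃ n ≥ a, R^[n] ⁻¹' B (n + k) := by
        ext z; simp [frequently_atTop]
      rw [this]
      exact .iInter fun a => .iUnion fun n => .iUnion fun _ => (hR.iterate n).measurable (hB _)
    · ext z
      simp only [Set.preimage_ofPred_eq, Set.mem_ofPred_eq, ← Function.iterate_add_apply]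
      simp only [frequently_atTop]
      constructor
      · intro h a
        obtain ⟨b, hb, h'⟩ := h a
        exact ⟨b + k, by omega, h'⟩
      · intro h a
        obtain ⟨b, hb, h'⟩ := h (a + k)
        refine ⟨b - k, by omega, ?_⟩
        rwa [Nat.sub_add_cancel (by omega)]
  · rw [eventuallyEq_set]
    filter_upwards [ae_all_iff.2 fun n => eventuallyEq_set.1 (hAB n)] with z hz
    simp only [Set.mem_preimage] at hz
    simp [← hz]

end Tail

/-! ### Factoring maps through a factor, and factor maps for sub-σ-algebras. -/

section JointFactor

open ProbabilityTheory

/-- A parametrized family of maps, measurable modulo null sets with respect to a factor `π`, factors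
through `π` jointly measurably in the parameter. -/
theorem exists_measurable_joint_factor {P Z Ω Ω' : Type*} [MeasurableSpace P] [MeasurableSpace Z]
    [StandardBorelSpace Z] [Nonempty Z] [MeasurableSpace Ω] [MeasurableSpace Ω']
    [StandardBorelSpace Ω'] (η : Measure Z) [SFinite η] {π : Z → Ω} (hπ : Measurable π)
    {F : P × Z → Ω'} (hF : Measurable F) [Nonempty Ω'] :
    ∃ φ : P × Ω → Ω', Measurable φ ∧ ∀ p : P,
      (∀ E, MeasurableSet E →
        ∃ C, MeasurableSet C ∧ (fun z => F (p, z)) ⁻¹' E =ᵐ[η] π ⁻¹' C) →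
      (fun z => F (p, z)) =ᵐ[η] fun z => φ (p, π z) := by
  classical
  -- The conditional law of `z` given `π z`. It is taken for `toFinite`, which is finite and has the
  -- same null sets as `η`.
  set κ := condDistrib (id : Z → Z) π η.toFinite
  obtain ⟨e, he, hi⟩ := MeasurableSpace.measurable_injection_nat_bool_of_countablySeparated Ω'
  have hemb : MeasurableEmbedding e := he.measurableEmbedding hi
  let s : ℕ → Set (P × Z) := fun n => {q | e (F q) n = true}
  have hb : ∀ n, MeasurableSet {x : Ω' | e x n = true} := fun n =>
    ((measurable_pi_apply n).comp he) (measurableSet_singleton true)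
  have hs : ∀ n, MeasurableSet (s n) := fun n => hF (hb n)
  have hmeas : ∀ n, Measurable fun q : P × Ω => κ q.2 (Prod.mk q.1 ⁻¹' s n) := by
    intro n
    have := Kernel.measurable_kernel_prodMk_left (κ := κ.comap (Prod.snd : P × Ω → Ω) measurable_snd)
      (t := {q : (P × Ω) × Z | (q.1.1, q.2) ∈ s n})
      (((measurable_fst.comp measurable_fst).prodMk measurable_snd) (hs n))
    exact this
  -- After coding `Ω'` in `ℕ → Bool`, each bit of `F (p, ·)` is a function of `π` modulo null sets,
  -- so its conditional probability is 0 or 1 and recovers the bit. Kernel measurability makes this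
  -- recipe jointly measurable in `p`, which separate choices for each `p` would not be.
  let φ₀ : P × Ω → ℕ → Bool := fun q n => decide (κ q.2 (Prod.mk q.1 ⁻¹' s n) = 1)
  have hφ₀ : Measurable φ₀ := by
    refine measurable_pi_lambda _ fun n => ?_
    refine measurable_to_bool ?_
    have : (fun q => φ₀ q n) ⁻¹' {true} = (fun q : P × Ω => κ q.2 (Prod.mk q.1 ⁻¹' s n)) ⁻¹' {1} := by
      ext q; simp [φ₀]
    rw [this]
    exact hmeas n (measurableSet_singleton 1)
  refine ⟨hemb.invFun ∘ φ₀, hemb.measurable_invFun.comp hφ₀, fun p hp => ?_⟩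
  have key : ∀ n, ∀ᵐ z ∂η, φ₀ (p, π z) n = e (F (p, z)) n := by
    intro n
    obtain ⟨C, hC, hCe⟩ := hp _ (hb n)
    refine (absolutelyContinuous_toFinite η).ae_le ?_
    have hCe' := (toFinite_absolutelyContinuous η).ae_le hCe
    have h1 := condDistrib_ae_eq_condExp (μ := η.toFinite) (X := π) (Y := (id : Z → Z)) hπ
      measurable_id (s := Prod.mk p ⁻¹' s n) (measurable_prodMk_left (hs n))
    have h2 : (η.toFinite)[((id : Z → Z) ⁻¹' (Prod.mk p ⁻¹' s n)).indicator (fun _ => (1 : ℝ)) |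
        MeasurableSpace.comap π inferInstance] =ᵐ[η.toFinite]
        (π ⁻¹' C).indicator (fun _ => (1 : ℝ)) := by
      refine (condExp_congr_ae (indicator_ae_eq_of_ae_eq_set hCe')).trans ?_
      rw [condExp_of_stronglyMeasurable hπ.comap_le]
      · exact (stronglyMeasurable_const).indicator ⟨C, hC, rfl⟩
      · exact (integrable_const _).indicator (hπ hC)
    filter_upwards [h1, h2, eventuallyEq_set.1 hCe'] with z h1 h2 h3
    rw [h2] at h1
    change (κ (π z)).real (Prod.mk p ⁻¹' s n) = _ at h1
    simp only [φ₀]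
    have h3' : e (F (p, z)) n = true ↔ z ∈ π ⁻¹' C := h3
    by_cases hz : z ∈ π ⁻¹' C
    · rw [h3'.2 hz, decide_eq_true_iff]
      rw [Set.indicator_of_mem hz, measureReal_def] at h1
      rwa [ENNReal.toReal_eq_one_iff] at h1
    · have : e (F (p, z)) n = false := by
        rw [← Bool.not_eq_true, h3']; exact hz
      rw [this, decide_eq_false_iff_not]
      rw [Set.indicator_of_notMem hz, measureReal_def] at h1
      intro h4
      rw [h4] at h1
      simp at h1
  filter_upwards [ae_all_iff.2 key] with z hz
  have : φ₀ (p, π z) = e (F (p, z)) := funext hz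
  simp only [Function.comp_apply, this]
  exact (hemb.leftInverse_invFun _).symm

theorem exists_measurable_factor {Z Ω Ω' : Type*} [MeasurableSpace Z]
    [StandardBorelSpace Z] [Nonempty Z] [MeasurableSpace Ω] [MeasurableSpace Ω']
    [StandardBorelSpace Ω'] [Nonempty Ω'] (η : Measure Z) [SFinite η] {π : Z → Ω}
    (hπ : Measurable π) {F : Z → Ω'} (hF : Measurable F)
    (h : ∀ E, MeasurableSet E → ∃ C, MeasurableSet C ∧ F ⁻¹' E =ᵐ[η] π ⁻¹' C) :
    ∃ φ : Ω → Ω', Measurable φ ∧ F =ᵐ[η] φ ∘ π := by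
  obtain ⟨φ, hφ, h'⟩ := exists_measurable_joint_factor (P := Unit) η hπ
    (F := fun p => F p.2) (hF.comp measurable_snd)
  exact ⟨fun ω => φ ((), ω), hφ.comp measurable_prodMk_left, h' () h⟩

/-- Every sub-`σ`-algebra of a standard probability space is, modulo null sets, generated by a
measurable map to a standard Borel space. -/
theorem exists_factor_map {Z : Type*} {𝒦 : MeasurableSpace Z} [mZ : MeasurableSpace Z]
    [StandardBorelSpace Z] (μ : Measure Z) [IsProbabilityMeasure μ] (h𝒦 : 𝒦 ≤ mZ) :
    ∃ π : Z → (ℚ → ENNReal), Measurable π ∧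
      SameModNull μ (MeasurableSpace.comap π inferInstance) 𝒦 := by
  obtain ⟨e, he⟩ := exists_measurableEmbedding_real Z
  set κ := condExpKernel μ 𝒦
  -- Rational half-lines are a countable generating π-system, so these values determine the whole
  -- conditional kernel, measurably.
  let π : Z → (ℚ → ENNReal) := fun z q => κ z (e ⁻¹' Set.Iic (q : ℝ))
  have hπ𝒦 : Measurable[𝒦] π := by
    refine @measurable_pi_lambda _ _ _ 𝒦 _ _ fun q => ?_
    exact measurable_condExpKernel (he.measurable measurableSet_Iic)
  have hπ : Measurable π := hπ𝒦.mono h𝒦 le_rfl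
  have hκ : Measurable[MeasurableSpace.comap π inferInstance] (fun z => (κ z : Measure Z)) := by
    refine @Measurable.measure_of_isPiSystem_of_isProbabilityMeasure Z Z
      (MeasurableSpace.comap π inferInstance) mZ (fun z => κ z) (fun z => inferInstance)
      (Set.preimage e '' (⋃ a : ℚ, {Set.Iic (a : ℝ)})) ?_ ?_ ?_
    · rw [← MeasurableSpace.comap_generateFrom, ← Real.borel_eq_generateFrom_Iic_rat,
        ← he.comap_eq, ← BorelSpace.measurable_eq (α := ℝ)]
    · exact Real.isPiSystem_Iic_rat.comap e
    · rintro _ ⟨s, hs, rfl⟩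
      obtain ⟨q, rfl⟩ := by simpa using hs
      exact @Measurable.comp _ _ _ (_) _ _ _ _ (measurable_pi_apply q) (comap_measurable π)
  refine ⟨π, hπ, ?_, ?_⟩
  · rintro _ ⟨C, hC, rfl⟩
    exact ⟨π ⁻¹' C, hπ𝒦 hC, ae_eq_rfl⟩
  · intro K hK
    -- For `K` in `𝒦` the conditional probability of `K` is almost everywhere its indicator.
    refine ⟨{z | κ z K = 1}, ?_, ?_⟩
    · have := @Measurable.comp _ _ _ (_) _ _ _ _ (Measure.measurable_coe (h𝒦 _ hK)) hκ
      exact this (measurableSet_singleton 1)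
    · rw [eventuallyEq_set]
      have h1 := condExpKernel_ae_eq_condExp (μ := μ) h𝒦 (h𝒦 _ hK)
      rw [condExp_of_stronglyMeasurable h𝒦
        ((@stronglyMeasurable_const _ _ 𝒦 _ _).indicator hK)
        ((integrable_const _).indicator (h𝒦 _ hK))] at h1
      filter_upwards [h1] with z hz
      change (κ z).real K = _ at hz
      by_cases h : z ∈ K
      · rw [Set.indicator_of_mem h, measureReal_def, ENNReal.toReal_eq_one_iff] at hz
        simp [h, hz]
      · rw [Set.indicator_of_notMem h, measureReal_def] at hz
        simp only [h, iff_false]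
        intro h4
        rw [h4] at hz
        simp at hz

end JointFactor

namespace ClassPreserving

variable {X Y : Type*} [MeasurableSpace X] [MeasurableSpace Y] {μ μ' : Measure X}
  {ν ν' : Measure Y}

theorem congr {T : X → Y} (h : ClassPreserving T μ ν) (h₁ : μ ≪ μ') (h₂ : μ' ≪ μ) (h₃ : ν ≪ ν')
    (h₄ : ν' ≪ ν) : ClassPreserving T μ' ν' :=
  ⟨h.measurable, fun A hA => by
    have := h.null_iff A hA
    exact ⟨fun h0 => h₄ (this.1 (h₁ h0)), fun h0 => h₂ (this.2 (h₃ h0))⟩⟩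

end ClassPreserving

theorem SameModNull.exists_preimage {Z Ω : Type*} {𝒦 : MeasurableSpace Z} [MeasurableSpace Z]
    {μ : Measure Z} [mΩ : MeasurableSpace Ω] {π : Z → Ω} (hs : SameModNull μ (mΩ.comap π) 𝒦)
    (K : Set Z) (hK : MeasurableSet[𝒦] K) : ∃ E, MeasurableSet E ∧ K =ᵐ[μ] π ⁻¹' E := by
  obtain ⟨_, ⟨E, hE, rfl⟩, e⟩ := hs.2 K hK
  exact ⟨E, hE, e.symm⟩

/-! ### The right shift and the factor actions it induces. -/

theorem rightShift_mul {X G : Type*} [Group G] (s t : G) :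
    rightShift X (s * t) = rightShift X s ∘ rightShift X t := by
  ext z <;> simp [rightShift, mul_assoc]

theorem rightShift_one {X G : Type*} [Group G] : rightShift X (1 : G) = id := by
  ext z <;> simp [rightShift]

theorem rightShift_comp_skewProduct {X G : Type*} [Group G] (T : X → X) (f : X → G) (t : G) :
    rightShift X t ∘ skewProduct T f = skewProduct T f ∘ rightShift X t := by
  ext z <;> simp [rightShift, skewProduct, mul_assoc]

/-- Every invariant sub-`σ`-algebra of a non-singular Borel action gives a factor action. -/
theorem exists_factor_action {G : Type uG} [Group G] [MeasurableSpace G] {Z : Type*}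
    {𝒦 : MeasurableSpace Z} [mZ : MeasurableSpace Z] [StandardBorelSpace Z] (ℙ : Measure Z)
    [IsProbabilityMeasure ℙ] {Q : G → Z → Z} (hQm : Measurable fun p : G × Z => Q p.1 p.2)
    (hQ : ∀ t, ClassPreserving (Q t) ℙ ℙ) (hQ_one : Q 1 = id)
    (hQ_mul : ∀ s t, Q (s * t) = Q s ∘ Q t) (h𝒦 : 𝒦 ≤ mZ)
    (hinv : ∀ (t : G) (K : Set Z), MeasurableSet[𝒦] K → MeasurableSet[𝒦] (Q t ⁻¹' K)) :
    ∃ (A : NSAction.{uG, 0} G) (π : Z → A.Ω), Measurable π ∧ ℙ.map π = A.μ ∧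
      (∀ t : G, π ∘ Q t =ᵐ[ℙ] A.act t ∘ π) ∧ SameModNull ℙ (A.mΩ.comap π) 𝒦 := by
  have : Nonempty Z := nonempty_of_isProbabilityMeasure ℙ
  obtain ⟨π, hπ, hsame⟩ := exists_factor_map ℙ h𝒦
  obtain ⟨φ, hφ, hφπ⟩ := exists_measurable_joint_factor (P := G) ℙ hπ
    (F := fun p => π (Q p.1 p.2)) (hπ.comp hQm)
  have heq : ∀ t : G, π ∘ Q t =ᵐ[ℙ] (fun ω => φ (t, ω)) ∘ π := by
    refine fun t => hφπ t fun E hE => ?_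
    -- Invariance of `𝒦` under `Q t` is what makes `π ∘ Q t` a function of `π`.
    obtain ⟨K, hK, e⟩ := hsame.1 (π ⁻¹' E) ⟨E, hE, rfl⟩
    obtain ⟨_, ⟨C, hC, rfl⟩, e'⟩ := hsame.2 _ (hinv t K hK)
    exact ⟨C, hC, ((hQ t).preimage_ae_eq e).trans e'.symm⟩
  have hφt : ∀ t : G, Measurable fun ω => φ (t, ω) := fun t => hφ.comp measurable_prodMk_left
  have hπc : ClassPreserving π ℙ (ℙ.map π) := ⟨hπ, fun E hE => by rw [Measure.map_apply hπ hE]⟩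
  have hns : ∀ t : G, IsNonsingular (fun ω => φ (t, ω)) (ℙ.map π) := fun t =>
    ⟨hφt t, fun E hE => by
      rw [← hπc.null_iff _ (hφt t hE), ← hπc.null_iff _ hE,
        ← (hQ t).null_iff _ (hπ hE), ← Set.preimage_comp, ← Set.preimage_comp]
      exact iff_of_eq (congrArg (· = 0) (measure_congr ((heq t).symm.preimage E)))⟩
  have hprobπ : IsProbabilityMeasure (ℙ.map π) := Measure.isProbabilityMeasure_map hπ.aemeasurable
  let A : NSAction.{uG, 0} G :=
    { Ω := ℚ → ENNReal
      μ := ℙ.map π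
      act := fun t ω => φ (t, ω)
      measurable_act := hφ
      nonsingular := hns
      act_one := by
        rw [← hπc.comp_ae_eq_iff (hφt 1) measurable_id]
        refine (heq 1).symm.trans ?_
        rw [hQ_one]; rfl
      act_mul := fun g h => by
        rw [← hπc.comp_ae_eq_iff (hφt (g * h)) ((hφt g).comp (hφt h))]
        refine (heq (g * h)).symm.trans ?_
        rw [hQ_mul, ← Function.comp_assoc]
        refine ((hQ h).comp_ae_eq (heq g)).trans ?_
        exact (heq h).fun_comp (fun ω => φ (g, ω)) }
  exact ⟨A, π, hπ, rfl, heq, hsame⟩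

/-! ### Existence and uniqueness of the associated actions. -/

section Shift

set_option linter.unusedSectionVars false

variable {G : Type uG} [Group G] [TopologicalSpace G] [IsTopologicalGroup G]
  [LocallyCompactSpace G] [PolishSpace G] [MeasurableSpace G] [BorelSpace G]
  {X : Type*} [MeasurableSpace X] {m : Measure X}

/-- Haar measure here is left invariant and `G` need not be unimodular, so right translation
preserves only the null sets. -/
theorem classPreserving_rightShift (t : G) :
    ClassPreserving (rightShift X t) (m.prod Measure.haar) (m.prod (Measure.haar (G := G))) :=
  ClassPreserving.fibred (T := id) .id (F := fun _ g => g * t⁻¹) (by fun_prop) fun _ =>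
    ⟨by fun_prop, fun _ _ => measure_mul_right_null _ _⟩

theorem classPreserving_skewProduct {T : X → X} (hT : IsNonsingular T m) {f : X → G}
    (hf : Measurable f) :
    ClassPreserving (skewProduct T f) (m.prod Measure.haar) (m.prod Measure.haar) :=
  ClassPreserving.fibred hT.classPreserving (F := fun x g => f x * g) (by fun_prop) fun x =>
    (measurePreserving_mul_left Measure.haar (f x)).classPreserving

theorem measurable_rightShift_joint :
    Measurable fun p : G × (X × G) => rightShift X p.1 p.2 := by
  unfold rightShift; fun_prop

theorem exists_measure_classPreserving [IsProbabilityMeasure m] :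
    ∃ ℙ : Measure (X × G), IsProbabilityMeasure ℙ ∧ ℙ ≪ m.prod Measure.haar ∧
      m.prod Measure.haar ≪ ℙ ∧ ∀ t : G, ClassPreserving (rightShift X t) ℙ ℙ := by
  have hne : NeZero (m.prod (Measure.haar (G := G))) := by
    refine ⟨?_⟩
    rw [Ne, ← Measure.measure_univ_eq_zero, ← Set.univ_prod_univ, Measure.prod_prod]
    simpa using NeZero.ne (Measure.haar (G := G))
  have h₁ := toFinite_absolutelyContinuous (m.prod (Measure.haar (G := G)))
  have h₂ := absolutelyContinuous_toFinite (m.prod (Measure.haar (G := G)))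
  exact ⟨_, inferInstance, h₁, h₂, fun t => (classPreserving_rightShift t).congr h₂ h₁ h₂ h₁⟩

theorem measurableSet_invariants_rightShift {T : X → X} {f : X → G} (t : G) (K : Set (X × G))
    (hK : MeasurableSet[MeasurableSpace.invariants (skewProduct T f)] K) :
    MeasurableSet[MeasurableSpace.invariants (skewProduct T f)] (rightShift X t ⁻¹' K) := by
  rw [MeasurableSpace.measurableSet_invariants] at hK ⊢
  refine ⟨(measurable_rightShift_joint.comp measurable_prodMk_left) hK.1, ?_⟩
  rw [← Set.preimage_comp, rightShift_comp_skewProduct, Set.preimage_comp, hK.2]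

theorem measurableSet_tailAlgebra_rightShift {T : X → X} {f : X → G} (t : G) (K : Set (X × G))
    (hK : MeasurableSet[tailAlgebra (skewProduct T f)] K) :
    MeasurableSet[tailAlgebra (skewProduct T f)] (rightShift X t ⁻¹' K) := by
  rw [measurableSet_tailAlgebra] at hK ⊢
  intro n
  obtain ⟨B, hB, rfl⟩ := hK n
  refine ⟨rightShift X t ⁻¹' B, (measurable_rightShift_joint.comp measurable_prodMk_left) hB, ?_⟩
  have : Function.Semiconj (rightShift X t) (skewProduct T f)^[n] (skewProduct T f)^[n] :=
    Function.Semiconj.iterate_right (fun z => congrFun (rightShift_comp_skewProduct T f t) z) n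
  rw [← Set.preimage_comp, ← Set.preimage_comp, this.comp_eq]

/-- `A`, with the map `π`, is a realization, up to the measure class, of the factor of the maps
`Q_t` on `(X × G, η)` given by the sets in `𝒦`. -/
structure Realizes (η : Measure (X × G)) (𝒦 : Set (Set (X × G))) (A : NSAction.{uG, v} G)
    (π : X × G → A.Ω) : Prop where
  classPreserving : ClassPreserving π η A.μ
  equivariant : ∀ t : G, π ∘ rightShift X t =ᵐ[η] A.act t ∘ π
  exists_mem : ∀ E : Set A.Ω, MeasurableSet E → ∃ K ∈ 𝒦, π ⁻¹' E =ᵐ[η] K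
  exists_preimage : ∀ K ∈ 𝒦, ∃ E : Set A.Ω, MeasurableSet E ∧ K =ᵐ[η] π ⁻¹' E

/-- Only the null sets of `ℙ` matter. Passing to a fixed reference measure makes realizations built
from different `ℙ` comparable. -/
theorem IsShiftFactor.realizes {η ℙ : Measure (X × G)} {𝒦 : Set (Set (X × G))}
    {A : NSAction.{uG, v} G} {π : X × G → A.Ω} (h₁ : ℙ ≪ η) (h₂ : η ≪ ℙ)
    (h : IsShiftFactor ℙ A π) (hs₁ : ∀ E : Set A.Ω, MeasurableSet E → ∃ K ∈ 𝒦, π ⁻¹' E =ᵐ[ℙ] K)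
    (hs₂ : ∀ K ∈ 𝒦, ∃ E : Set A.Ω, MeasurableSet E ∧ K =ᵐ[ℙ] π ⁻¹' E) : Realizes η 𝒦 A π where
  classPreserving :=
    ⟨h.measurable, fun E hE => by
      rw [← h.map_eq, Measure.map_apply h.measurable hE]
      exact ⟨fun h0 => h₁ h0, fun h0 => h₂ h0⟩⟩
  equivariant t := h₂.ae_le (h.equivariant t)
  exists_mem E hE := let ⟨K, hK, e⟩ := hs₁ E hE; ⟨K, hK, h₂.ae_le e⟩
  exists_preimage K hK := let ⟨E, hE, e⟩ := hs₂ K hK; ⟨E, hE, h₂.ae_le e⟩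

theorem IsInvariantAction.exists_realizes {T : X → X} {f : X → G} {A : NSAction.{uG, v} G}
    (h : IsInvariantAction m T f A) :
    ∃ π, Realizes (m.prod Measure.haar) 
      {K | MeasurableSet[MeasurableSpace.invariants (skewProduct T f)] K} A π := by
  obtain ⟨ℙ, π, _, h₁, h₂, hπ, -, hs⟩ := h
  exact ⟨π, hπ.realizes h₁ h₂ (fun E hE => hs.1 _ ⟨E, hE, rfl⟩) hs.exists_preimage⟩

theorem IsTailAction.exists_realizes {T : X → X} {f : X → G} {A : NSAction.{uG, v} G}
    (h : IsTailAction m T f A) :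
    ∃ π, Realizes (m.prod Measure.haar) 
      {K | MeasurableSet[tailAlgebra (skewProduct T f)] K} A π := by
  obtain ⟨ℙ, π, _, h₁, h₂, hπ, hs⟩ := h
  exact ⟨π, hπ.realizes h₁ h₂ (fun E hE => hs.1 _ ⟨E, hE, rfl⟩) hs.exists_preimage⟩

theorem exists_isTailAction [StandardBorelSpace X] [IsProbabilityMeasure m] (T : X → X)
    (f : X → G) : ∃ A : NSAction.{uG, 0} G, IsTailAction m T f A := by
  obtain ⟨ℙ, _, h₁, h₂, hQ⟩ := exists_measure_classPreserving (G := G) (m := m)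
  obtain ⟨A, π, hπ, hmap, heq, hs⟩ := exists_factor_action ℙ measurable_rightShift_joint hQ
    rightShift_one rightShift_mul (tailAlgebra_le (R := skewProduct T f))
    measurableSet_tailAlgebra_rightShift
  exact ⟨A, ℙ, π, inferInstance, h₁, h₂, ⟨hπ, hmap, heq⟩, hs⟩

/-- A map whose preimages are invariant modulo null sets is invariant modulo null sets. -/
theorem comp_ae_eq_self_of_sameModNull {Z Ω : Type*} [MeasurableSpace Z] [MeasurableSpace Ω]
    [StandardBorelSpace Ω] {η : Measure Z} {R : Z → Z} (hR : ClassPreserving R η η) {π : Z → Ω}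
    (hs : ∀ E, MeasurableSet E →
      ∃ K, MeasurableSet[MeasurableSpace.invariants R] K ∧ π ⁻¹' E =ᵐ[η] K) :
    π ∘ R =ᵐ[η] π := by
  -- Coding points by countably many sets turns an almost everywhere equality of maps into countably
  -- many equalities of sets.
  obtain ⟨e, he, hi⟩ := MeasurableSpace.measurable_injection_nat_bool_of_countablySeparated Ω
  have key : ∀ n, ∀ᵐ z ∂η, e (π (R z)) n = true ↔ e (π z) n = true := by
    intro n
    have hn : MeasurableSet {ω : Ω | e ω n = true} :=
      ((measurable_pi_apply n).comp he) (measurableSet_singleton true)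
    obtain ⟨K, hK, e'⟩ := hs _ hn
    have h2 := (hR.preimage_ae_eq e')
    rw [(MeasurableSpace.measurableSet_invariants.1 hK).2] at h2
    exact eventuallyEq_set.1 (h2.trans e'.symm)
  filter_upwards [ae_all_iff.2 key] with z hz
  exact hi (funext fun n => Bool.eq_iff_iff.2 (hz n))

theorem exists_isInvariantAction [StandardBorelSpace X] [IsProbabilityMeasure m] {T : X → X}
    (hT : IsNonsingular T m) {f : X → G} (hf : Measurable f) :
    ∃ A : NSAction.{uG, 0} G, IsInvariantAction m T f A := by
  obtain ⟨ℙ, _, h₁, h₂, hQ⟩ := exists_measure_classPreserving (G := G) (m := m)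
  obtain ⟨A, π, hπ, hmap, heq, hs⟩ := exists_factor_action ℙ measurable_rightShift_joint hQ
    rightShift_one rightShift_mul (MeasurableSpace.invariants_le (skewProduct T f))
    measurableSet_invariants_rightShift
  exact ⟨A, ℙ, π, inferInstance, h₁, h₂, ⟨hπ, hmap, heq⟩, comp_ae_eq_self_of_sameModNull
    ((classPreserving_skewProduct hT hf).congr h₂ h₁ h₂ h₁) (fun E hE => hs.1 _ ⟨E, hE, rfl⟩), hs⟩

/-- Realizations of the same factor are isomorphic. -/
theorem Realizes.isomorphic [StandardBorelSpace X] {η : Measure (X × G)} [SFinite η]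
    {𝒦 : Set (Set (X × G))}
    (hQ : ∀ t : G, ClassPreserving (rightShift X t) η η) {A : NSAction.{uG, v} G}
    {B : NSAction.{uG, w} G} {π : X × G → A.Ω} {σ : X × G → B.Ω} (hA : Realizes η 𝒦 A π)
    (hB : Realizes η 𝒦 B σ) : A.Isomorphic B := by
  have hneA : Nonempty A.Ω := nonempty_of_isProbabilityMeasure A.μ
  have hneB : Nonempty B.Ω := nonempty_of_isProbabilityMeasure B.μ
  have hne : Nonempty (X × G) := by
    by_contra hcon
    rw [not_nonempty_iff] at hcon
    have h := (hA.classPreserving.null_iff _ .univ).1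
      (by rw [Set.eq_empty_of_isEmpty (π ⁻¹' Set.univ), measure_empty])
    simp at h
  have hπ := hA.classPreserving.measurable
  have hσ := hB.classPreserving.measurable
  -- Both maps generate the same sets modulo null sets, so each is a function of the other. The
  -- identities for `φ` and `ψ` are then checked after pulling back along `π` or `σ`.
  obtain ⟨φ, hφ, eφ⟩ := exists_measurable_factor η hπ hσ fun E hE => by
    obtain ⟨K, hK, e⟩ := hB.exists_mem E hE
    obtain ⟨C, hC, e'⟩ := hA.exists_preimage K hK
    exact ⟨C, hC, e.trans e'⟩
  obtain ⟨ψ, hψ, eψ⟩ := exists_measurable_factor η hσ hπ fun E hE => by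
    obtain ⟨K, hK, e⟩ := hA.exists_mem E hE
    obtain ⟨C, hC, e'⟩ := hB.exists_preimage K hK
    exact ⟨C, hC, e.trans e'⟩
  have qφ : ClassPreserving φ A.μ B.μ := ⟨hφ, fun E hE => by
    rw [← hA.classPreserving.null_iff _ (hφ hE), ← hB.classPreserving.null_iff _ hE,
      ← Set.preimage_comp]
    exact iff_of_eq (congrArg (· = 0) (measure_congr (eφ.symm.preimage E)))⟩
  have qψ : ClassPreserving ψ B.μ A.μ := ⟨hψ, fun E hE => by
    rw [← hB.classPreserving.null_iff _ (hψ hE), ← hA.classPreserving.null_iff _ hE,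
      ← Set.preimage_comp]
    exact iff_of_eq (congrArg (· = 0) (measure_congr (eψ.symm.preimage E)))⟩
  refine ⟨φ, ψ, qφ.quasiMeasurePreserving, qψ.quasiMeasurePreserving, ?_, ?_, fun g => ?_⟩
  · rw [← hA.classPreserving.comp_ae_eq_iff (hψ.comp hφ) measurable_id]
    exact (eφ.symm.fun_comp ψ).trans eψ.symm
  · rw [← hB.classPreserving.comp_ae_eq_iff (hφ.comp hψ) measurable_id]
    exact (eψ.symm.fun_comp φ).trans eφ.symm
  · rw [← hA.classPreserving.comp_ae_eq_iff (hφ.comp (A.nonsingular g).measurable)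
      ((B.nonsingular g).measurable.comp hφ)]
    have h1 : φ ∘ A.act g ∘ π =ᵐ[η] φ ∘ π ∘ rightShift X g := (hA.equivariant g).symm.fun_comp φ
    have h2 : (φ ∘ π) ∘ rightShift X g =ᵐ[η] σ ∘ rightShift X g := (hQ g).comp_ae_eq eφ.symm
    have h3 : B.act g ∘ σ =ᵐ[η] B.act g ∘ φ ∘ π := eφ.fun_comp (B.act g)
    exact h1.trans (h2.trans ((hB.equivariant g).trans h3))

end Shift

/-! ### Ergodicity and exactness read off the shift factor. -/

section Ergodic

set_option linter.unusedSectionVars false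

variable {G : Type uG} [Group G] [TopologicalSpace G] [IsTopologicalGroup G]
  [LocallyCompactSpace G] [PolishSpace G] [MeasurableSpace G] [BorelSpace G]
  {X : Type*} [MeasurableSpace X] {m : Measure X}

theorem classPreserving_fst_haar :
    ClassPreserving Prod.fst (m.prod (Measure.haar (G := G))) m :=
  ⟨measurable_fst, fun A _ => by
    rw [← Set.prod_univ, Measure.prod_prod, mul_eq_zero, or_iff_left]
    simpa using NeZero.ne (Measure.haar (G := G))⟩

theorem classPreserving_mul_inv (g : G) :
    ClassPreserving (fun t : G => g * t⁻¹) Measure.haar Measure.haar :=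
  ClassPreserving.comp (T := fun t : G => t⁻¹)
    (measurePreserving_mul_left Measure.haar g).classPreserving
    ⟨measurable_inv, fun _ _ => measure_inv_null _⟩

/-- A set which is invariant under all right shifts modulo null sets is a cylinder modulo null
sets. -/
theorem exists_ae_eq_preimage_fst [SFinite m] {W : Set (X × G)} (hW : MeasurableSet W)
    (h : ∀ t : G, rightShift X t ⁻¹' W =ᵐ[m.prod Measure.haar] W) :
    ∃ D : Set X, MeasurableSet D ∧ W =ᵐ[m.prod Measure.haar] Prod.fst ⁻¹' D := by
  have h1 : ∀ᵐ z ∂(m.prod (Measure.haar (G := G))), ∀ᵐ t ∂(Measure.haar (G := G)),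
      (rightShift X t z ∈ W ↔ z ∈ W) := by
    -- Fubini turns "for every `t`, for almost every `z`" into "for almost every `z`, for almost
    -- every `t`".
    rw [← Measure.ae_ae_comm
      (p := fun t z => rightShift X t z ∈ W ↔ z ∈ W)
      (measurableSet_mem_iff_mem (measurable_rightShift_joint hW) (measurable_snd hW))]
    exact Eventually.of_forall fun t => eventuallyEq_set.1 (h t)
  have hD : MeasurableSet {x | Measure.haar (Prod.mk x ⁻¹' W) ≠ 0} :=
    measurable_measure_prodMk_left hW (measurableSet_singleton 0).compl
  refine ⟨_, hD, ?_⟩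
  rw [eventuallyEq_set, Measure.ae_prod_iff_ae_ae (measurableSet_mem_iff_mem hW (measurable_fst hD))]
  filter_upwards [Measure.ae_ae_of_ae_prod h1] with x hx
  by_cases h0 : Measure.haar (Prod.mk x ⁻¹' W) = 0
  · have h0' : ∀ᵐ g ∂(Measure.haar (G := G)), (x, g) ∉ W := measure_eq_zero_iff_ae_notMem.1 h0
    filter_upwards [h0'] with g hg
    simp [hg, h0]
  -- A non-null section contains a `g` with `g t⁻¹` in it for almost every `t`; since `t ↦ g t⁻¹`
  -- preserves the Haar class, the section is co-null.
  · obtain ⟨g, hg, hgt⟩ := ((frequently_ae_iff (p := fun g => (x, g) ∈ W)).2 h0).and_eventually hx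
      |>.exists
    have h2 : ∀ᵐ t ∂(Measure.haar (G := G)), (x, g * t⁻¹) ∈ W := by
      filter_upwards [hgt] with t ht
      exact ht.2 hg
    have h3 := ((classPreserving_mul_inv g).ae_iff (p := fun k => (x, k) ∈ W)
      (measurable_prodMk_left hW)).1 h2
    filter_upwards [h3] with k hk
    simp [hk, h0]

theorem null_or_conull_congr {Z : Type*} [MeasurableSpace Z] {μ : Measure Z} {A B : Set Z}
    (h : A =ᵐ[μ] B) : (μ A = 0 ∨ μ Aᶜ = 0) ↔ (μ B = 0 ∨ μ Bᶜ = 0) := by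
  rw [measure_congr h, measure_congr h.compl]

/-- The action on a factor of the shift is ergodic if and only if every base set which belongs to
the factor is trivial. -/
theorem Realizes.isErgodic_iff [SFinite m] {𝒦 : Set (Set (X × G))} {A : NSAction.{uG, v} G}
    {π : X × G → A.Ω} (hA : Realizes (m.prod Measure.haar) 𝒦 A π) :
    A.IsErgodic ↔ ∀ D : Set X, MeasurableSet D →
      (∃ K ∈ 𝒦, Prod.fst ⁻¹' D =ᵐ[m.prod Measure.haar] K) → m D = 0 ∨ m Dᶜ = 0 := by
  have hπ := hA.classPreserving
  have htriv : ∀ (D : Set X) (E : Set A.Ω), MeasurableSet D → MeasurableSet E →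
      π ⁻¹' E =ᵐ[m.prod Measure.haar] Prod.fst ⁻¹' D →
      ((A.μ E = 0 ∨ A.μ Eᶜ = 0) ↔ (m D = 0 ∨ m Dᶜ = 0)) := by
    intro D E hD hE e
    have hf := classPreserving_fst_haar (G := G) (m := m)
    rw [← hf.null_iff _ hD, ← hf.null_iff _ hD.compl, ← hπ.null_iff _ hE,
      ← hπ.null_iff _ hE.compl]
    exact null_or_conull_congr e
  have hshift : ∀ (t : G) (E : Set A.Ω), rightShift X t ⁻¹' (π ⁻¹' E) =ᵐ[m.prod Measure.haar]
      π ⁻¹' (A.act t ⁻¹' E) := fun t E => (hA.equivariant t).preimage E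
  constructor
  · rintro herg D hD ⟨K, hK, e⟩
    obtain ⟨E, hE, e'⟩ := hA.exists_preimage K hK
    refine (htriv D E hD hE (e.trans e').symm).1 (herg E hE fun t => ?_)
    rw [← hπ.preimage_ae_eq_iff ((A.nonsingular t).measurable hE) hE]
    refine (hshift t E).symm.trans ?_
    exact ((classPreserving_rightShift t).preimage_ae_eq (e.trans e').symm).trans (e.trans e')
  · intro h E hE hinv
    -- By equivariance an invariant `E` pulls back to a shift-invariant set, hence to a cylinder.
    obtain ⟨D, hD, e⟩ := exists_ae_eq_preimage_fst (hπ.measurable hE) fun t =>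
      (hshift t E).trans (hπ.preimage_ae_eq (hinv t))
    obtain ⟨K, hK, e'⟩ := hA.exists_mem E hE
    exact (htriv D E hD hE e).2 (h D hD ⟨K, hK, e.symm.trans e'⟩)

/-- The skew product lies over `T`, so invariance passes between `D` and `D × G`. The right side is
the criterion of `Realizes.isErgodic_iff`. -/
theorem quasiErgodic_iff_invariants [SFinite m] {T : X → X} (hT : IsNonsingular T m) {f : X → G}
    (hf : Measurable f) :
    QuasiErgodic T m ↔ ∀ D : Set X, MeasurableSet D →
      (∃ K ∈ {K | MeasurableSet[MeasurableSpace.invariants (skewProduct T f)] K},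
        Prod.fst ⁻¹' D =ᵐ[m.prod Measure.haar] K) → m D = 0 ∨ m Dᶜ = 0 := by
  have hR := classPreserving_skewProduct hT hf
  constructor
  · rintro h D hD ⟨K, hK, e⟩
    have e1 := hR.preimage_ae_eq e
    rw [(MeasurableSpace.measurableSet_invariants.1 hK).2] at e1
    have e2 : T ⁻¹' D =ᵐ[m] D := by
      rw [← (classPreserving_fst_haar (G := G)).preimage_ae_eq_iff (hT.measurable hD) hD]
      exact e1.trans e.symm
    rcases h.ae_empty_or_univ₀ hD.nullMeasurableSet e2 with h' | h'
    · exact Or.inl (ae_eq_empty.1 h')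
    · exact Or.inr (ae_eq_univ.1 h')
  · intro h
    refine ⟨hT.quasiMeasurePreserving, ⟨fun D hD hinv => ?_⟩⟩
    rw [eventuallyConst_set']
    refine (h D hD ⟨Prod.fst ⁻¹' D, ?_, ae_eq_rfl⟩).imp ae_eq_empty.2 ae_eq_univ.2
    refine MeasurableSpace.measurableSet_invariants.2 ⟨measurable_fst hD, ?_⟩
    change Prod.fst ⁻¹' (T ⁻¹' D) = _
    rw [hinv]

theorem fst_comp_skewProduct_iterate (T : X → X) (f : X → G) (n : ℕ) :
    Prod.fst ∘ (skewProduct T f)^[n] = T^[n] ∘ Prod.fst :=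
  (Function.Semiconj.iterate_right (f := Prod.fst) (fun _ => rfl) n).comp_eq

theorem rightShift_comp_skewProduct_iterate (T : X → X) (f : X → G) (t : G) (n : ℕ) :
    rightShift X t ∘ (skewProduct T f)^[n] = (skewProduct T f)^[n] ∘ rightShift X t :=
  (Function.Semiconj.iterate_right
    (fun z => congrFun (rightShift_comp_skewProduct T f t) z) n).comp_eq

theorem isExact_iff_tail [SFinite m] {T : X → X} (hT : IsNonsingular T m) {f : X → G}
    (hf : Measurable f) :
    IsExact T m ↔ ∀ D : Set X, MeasurableSet D →
      (∃ K ∈ {K | MeasurableSet[tailAlgebra (skewProduct T f)] K},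
        Prod.fst ⁻¹' D =ᵐ[m.prod Measure.haar] K) → m D = 0 ∨ m Dᶜ = 0 := by
  have hR := classPreserving_skewProduct hT hf
  have hfst := classPreserving_fst_haar (G := G) (m := m)
  constructor
  · rintro h D hD ⟨K, hK, e⟩
    obtain ⟨D', hD', e'⟩ := exists_tail_ae_eq hT.classPreserving (A := D) fun n => by
      obtain ⟨B, hB, rfl⟩ := measurableSet_tailAlgebra.1 hK n
      -- If `D × G` is the `n`-th preimage of `B`, then `B` is itself a cylinder: iterates of the
      -- skew product commute with the shift and reflect null sets, so `B` inherits shift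
      -- invariance.
      obtain ⟨D₁, hD₁, e₁⟩ := exists_ae_eq_preimage_fst hB fun t => by
        have ht := classPreserving_rightShift (X := X) (m := m) t
        rw [← (hR.iterate n).preimage_ae_eq_iff (ht.measurable hB) hB, ← Set.preimage_comp,
          rightShift_comp_skewProduct_iterate, Set.preimage_comp]
        exact (ht.preimage_ae_eq e.symm).trans e
      refine ⟨D₁, hD₁, ?_⟩
      rw [← hfst.preimage_ae_eq_iff hD ((hT.classPreserving.iterate n).measurable hD₁),
        ← Set.preimage_comp, ← fst_comp_skewProduct_iterate T f n, Set.preimage_comp]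
      exact e.trans ((hR.iterate n).preimage_ae_eq e₁)
    exact (null_or_conull_congr e').2 (h D' hD')
  · intro h D hD
    refine h D (tailAlgebra_le _ hD) ⟨Prod.fst ⁻¹' D, measurableSet_tailAlgebra.2 fun n => ?_,
      ae_eq_rfl⟩
    obtain ⟨B, hB, rfl⟩ := measurableSet_tailAlgebra.1 hD n
    exact ⟨Prod.fst ⁻¹' B, measurable_fst hB, by
      rw [← Set.preimage_comp, fst_comp_skewProduct_iterate, Set.preimage_comp]⟩

end Ergodic

/-! ### Untwisting the skew product over the Rokhlin endomorphism. -/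

section Product

set_option linter.unusedSectionVars false

theorem measurePreserving_prod_right_comm {X Y Z : Type*} [MeasurableSpace X] [MeasurableSpace Y]
    [MeasurableSpace Z] (μ : Measure X) (ν : Measure Y) (ρ : Measure Z) [SFinite μ] [SFinite ν]
    [SFinite ρ] :
    MeasurePreserving (fun z : (X × Y) × Z => ((z.1.1, z.2), z.1.2)) ((μ.prod ν).prod ρ)
      ((μ.prod ρ).prod ν) := by
  have h1 := measurePreserving_prodAssoc μ ν ρ
  have h2 := (MeasurePreserving.id μ).prod (Measure.measurePreserving_swap (μ := ν) (ν := ρ))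
  have h3 := (measurePreserving_prodAssoc μ ρ ν).symm
  exact h3.comp (h2.comp h1)

theorem ae_semiconj_iterate {X Y : Type*} [MeasurableSpace X] {μ : Measure X} {R : X → X}
    (hR : ClassPreserving R μ μ) {R' : Y → Y} {φ : X → Y} (h : φ ∘ R =ᵐ[μ] R' ∘ φ) (n : ℕ) :
    φ ∘ R^[n] =ᵐ[μ] R'^[n] ∘ φ := by
  induction n with
  | zero => exact ae_eq_rfl
  | succ n ih =>
    rw [Function.iterate_succ, Function.iterate_succ]
    exact (hR.comp_ae_eq ih).trans (h.fun_comp R'^[n])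

/-- Almost everywhere equality of sets in a product passes to almost every section. -/
theorem ae_section_ae_eq {Z Y : Type*} [MeasurableSpace Z] [MeasurableSpace Y] {η : Measure Z}
    {ν : Measure Y} [SFinite η] [SFinite ν] {A B : Set (Z × Y)} (h : A =ᵐ[η.prod ν] B) :
    ∀ᵐ y ∂ν, (fun z => (z, y)) ⁻¹' A =ᵐ[η] (fun z => (z, y)) ⁻¹' B := by
  have := (Measure.measurePreserving_swap (μ := ν) (ν := η)).quasiMeasurePreserving.ae
    (eventuallyEq_set.1 h)
  filter_upwards [Measure.ae_ae_of_ae_prod this] with y hy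
  exact eventuallyEq_set.2 hy

variable {G : Type uG} [Group G] [TopologicalSpace G] [IsTopologicalGroup G]
  [LocallyCompactSpace G] [PolishSpace G] [MeasurableSpace G] [BorelSpace G]
  {X : Type uX} [MeasurableSpace X] {m : Measure X}

/-- The group law holds only almost everywhere for each pair; Fubini extends it to group elements
depending measurably on a parameter. -/
theorem NSAction.act_act_ae (S : NSAction.{uG, uY} G) {P : Type*} [MeasurableSpace P]
    (ρ : Measure P) {a b : P → G} (ha : Measurable a) (hb : Measurable b) :
    ∀ᵐ q ∂ρ.prod S.μ, S.act (a q.1) (S.act (b q.1) q.2) = S.act (a q.1 * b q.1) q.2 := by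
  have hS := S.measurable_act
  have h1 : Measurable fun q : P × S.Ω => S.act (b q.1) q.2 :=
    hS.comp ((hb.comp measurable_fst).prodMk measurable_snd)
  have h2 : Measurable fun q : P × S.Ω => S.act (a q.1) (S.act (b q.1) q.2) :=
    hS.comp ((ha.comp measurable_fst).prodMk h1)
  have h3 : Measurable fun q : P × S.Ω => S.act (a q.1 * b q.1) q.2 :=
    hS.comp (((ha.mul hb).comp measurable_fst).prodMk measurable_snd)
  rw [Measure.ae_prod_iff_ae_ae (measurableSet_eq_fun h2 h3)]
  exact Eventually.of_forall fun p => (S.act_mul (a p) (b p)).symm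

theorem isNonsingular_rokhlin {T : X → X} (hT : IsNonsingular T m) {f : X → G}
    (hf : Measurable f) (S : NSAction.{uG, uY} G) :
    IsNonsingular (rokhlin T f S) (m.prod S.μ) :=
  (hT.classPreserving.fibred (F := fun x y => S.act (f x) y)
    (S.measurable_act.comp ((hf.comp measurable_fst).prodMk measurable_snd))
    fun x => (S.nonsingular (f x)).classPreserving).isNonsingular

/-- The map `((x, y), g) ↦ ((x, g), S_{g⁻¹} y)` which untwists the skew product over the Rokhlin
endomorphism. -/
def untwist (X : Type*) (S : NSAction.{uG, uY} G) (z : (X × S.Ω) × G) : (X × G) × S.Ω :=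
  ((z.1.1, z.2), S.act z.2⁻¹ z.1.2)

/-- The inverse modulo null sets `((x, g), y) ↦ ((x, S_g y), g)` of `untwist`. -/
def twist (X : Type*) (S : NSAction.{uG, uY} G) (z : (X × G) × S.Ω) : (X × S.Ω) × G :=
  ((z.1.1, S.act z.1.2 z.2), z.1.2)

variable {S : NSAction.{uG, uY} G} {T : X → X} {f : X → G}

theorem classPreserving_untwist [SFinite m] : ClassPreserving (untwist X S)
    ((m.prod S.μ).prod Measure.haar) ((m.prod Measure.haar).prod S.μ) := by
  have h := ClassPreserving.fibred (μ := m.prod (Measure.haar (G := G))) (ν := S.μ) (ν' := S.μ) .id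
    (F := fun z y => S.act z.2⁻¹ y)
    (S.measurable_act.comp ((measurable_snd.comp measurable_fst).inv.prodMk measurable_snd))
    fun z => (S.nonsingular z.2⁻¹).classPreserving
  exact h.comp (measurePreserving_prod_right_comm m S.μ Measure.haar).classPreserving

theorem classPreserving_twist [SFinite m] : ClassPreserving (twist X S)
    ((m.prod Measure.haar).prod S.μ) ((m.prod S.μ).prod Measure.haar) := by
  have h := ClassPreserving.fibred (μ := m.prod (Measure.haar (G := G))) (ν := S.μ) (ν' := S.μ) .id
    (F := fun z y => S.act z.2 y)
    (S.measurable_act.comp ((measurable_snd.comp measurable_fst).prodMk measurable_snd))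
    fun z => (S.nonsingular z.2).classPreserving
  exact (measurePreserving_prod_right_comm m Measure.haar S.μ).classPreserving.comp h

theorem twist_comp_untwist [SFinite m] :
    twist X S ∘ untwist X S =ᵐ[(m.prod S.μ).prod Measure.haar] id := by
  have h := S.act_act_ae (m.prod Measure.haar) (a := Prod.snd) (b := fun z : X × G => z.2⁻¹)
    measurable_snd measurable_snd.inv
  have h' : ∀ᵐ q ∂(m.prod (Measure.haar (G := G))).prod S.μ, S.act 1 q.2 = q.2 :=
    Measure.quasiMeasurePreserving_snd.ae S.act_one
  filter_upwards [(measurePreserving_prod_right_comm m S.μ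
    Measure.haar).quasiMeasurePreserving.ae (h.and h')] with z hz
  obtain ⟨h1, h2⟩ := hz
  simp only [mul_inv_cancel] at h1
  simp [twist, untwist, h1, h2]

theorem untwist_comp_skewProduct [SFinite m] (hf : Measurable f) :
    untwist X S ∘ skewProduct (rokhlin T f S) (fun z => f z.1)
      =ᵐ[(m.prod S.μ).prod Measure.haar] Prod.map (skewProduct T f) id ∘ untwist X S := by
  have h := S.act_act_ae (m.prod Measure.haar) (a := fun z : X × G => (f z.1 * z.2)⁻¹)
    (b := fun z => f z.1) (by fun_prop) (by fun_prop)
  filter_upwards [(measurePreserving_prod_right_comm m S.μ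
    Measure.haar).quasiMeasurePreserving.ae h] with z h1
  simp only [mul_inv_rev, inv_mul_cancel_right] at h1
  simp [untwist, skewProduct, rokhlin, h1]

/-- The source of the diagonal action: `(g t⁻¹)⁻¹ = t g⁻¹`, so the shift acts by `S_t` on the
untwisted fibre. -/
theorem untwist_comp_rightShift [SFinite m] (t : G) :
    untwist X S ∘ rightShift (X × S.Ω) t
      =ᵐ[(m.prod S.μ).prod Measure.haar] Prod.map (rightShift X t) (S.act t) ∘ untwist X S := by
  have h := S.act_act_ae (m.prod Measure.haar) (a := fun _ : X × G => t)
    (b := fun z => z.2⁻¹) (by fun_prop) (by fun_prop)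
  filter_upwards [(measurePreserving_prod_right_comm m S.μ
    Measure.haar).quasiMeasurePreserving.ae h] with z h1
  simp [untwist, rightShift, h1]

theorem twist_comp_skewProduct (hf : Measurable f) :
    twist X S ∘ Prod.map (skewProduct T f) id =ᵐ[(m.prod Measure.haar).prod S.μ]
      skewProduct (rokhlin T f S) (fun z => f z.1) ∘ twist X S := by
  have h := S.act_act_ae (m.prod Measure.haar) (a := fun z : X × G => f z.1)
    (b := fun z => z.2) (by fun_prop) (by fun_prop)
  filter_upwards [h] with z h1
  simp [twist, skewProduct, rokhlin, h1]

theorem classPreserving_prodMap_id {Z Z' Y : Type*} [MeasurableSpace Z] [MeasurableSpace Z']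
    [MeasurableSpace Y] {μ : Measure Z} {μ' : Measure Z'} {ν : Measure Y} [SFinite ν] {π : Z → Z'}
    (h : ClassPreserving π μ μ') : ClassPreserving (Prod.map π id) (μ.prod ν) (μ'.prod ν) :=
  h.fibred (F := fun _ y => y) measurable_snd fun _ => .id

theorem iterate_prodMap_id {Z Y : Type*} (R : Z → Z) (n : ℕ) :
    (Prod.map R (id : Y → Y))^[n] = Prod.map R^[n] id := by
  rw [Prod.map_iterate, Function.iterate_id]

variable {𝒦 : Set (Set (X × G))} {𝒦' : Set (Set ((X × S.Ω) × G))} {A : NSAction.{uG, uA} G}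
  {π : X × G → A.Ω}

/-- If almost all sections of a subset of a product belong to the factor given by `π`, then the
subset belongs to the factor given by `π × id`. -/
theorem exists_ae_eq_preimage_prodMap {Z Ω Y : Type*} [MeasurableSpace Z] [StandardBorelSpace Z]
    [Nonempty Z] [MeasurableSpace Ω] [MeasurableSpace Y] {η : Measure Z} {ν : Measure Y}
    [SFinite η] [SFinite ν] {π : Z → Ω} (hπ : Measurable π) {D : Set (Z × Y)}
    (hD : MeasurableSet D)
    (h : ∀ᵐ y ∂ν, ∃ C, MeasurableSet C ∧ (fun z => (z, y)) ⁻¹' D =ᵐ[η] π ⁻¹' C) :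
    ∃ E : Set (Ω × Y), MeasurableSet E ∧ D =ᵐ[η.prod ν] Prod.map π id ⁻¹' E := by
  classical
  -- The indicator of `D` is a family of maps with parameter `y`, so the sets `C` need not be chosen
  -- measurably in `y`.
  obtain ⟨φ, hφ, h'⟩ := exists_measurable_joint_factor (P := Y) η hπ
    (F := fun p => decide ((p.2, p.1) ∈ D)) ((measurable_decide_mem hD).comp measurable_swap)
  have hE : MeasurableSet {q : Ω × Y | φ q.swap = true} :=
    (hφ.comp measurable_swap) (measurableSet_singleton true)
  refine ⟨_, hE, ?_⟩
  have hE' := (hπ.prodMap (measurable_id (α := Y))) hE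
  have hiff := measurableSet_mem_iff_mem hD hE'
  rw [eventuallyEq_set, Measure.ae_prod_iff_ae_ae hiff, Measure.ae_ae_comm hiff]
  filter_upwards [h] with y hy
  obtain ⟨C, hC, e⟩ := hy
  have e' : (fun z => decide ((z, y) ∈ D)) =ᵐ[η] (fun ω => decide (ω ∈ C)) ∘ π := by
    filter_upwards [eventuallyEq_set.1 e] with z hz
    exact decide_eq_decide.2 hz
  filter_upwards [h' y fun E hE => ⟨(fun ω => decide (ω ∈ C)) ⁻¹' E, (measurable_decide_mem hC) hE,
    e'.preimage E⟩] with z hz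
  simp only [Set.mem_preimage, Prod.map, id, Set.mem_ofPred_eq, Prod.swap, ← hz,
    decide_eq_true_iff]

/-- The part common to the invariant and tail cases: only membership of pulled-back sets in `𝒦'`,
and of almost all untwisted sections in `𝒦`, depends on the algebra. -/
theorem Realizes.prod [StandardBorelSpace X] [IsProbabilityMeasure m]
    (hA : Realizes (m.prod Measure.haar) 𝒦 A π)
    (h₁ : ∀ C : Set (A.Ω × S.Ω), MeasurableSet C →
      ∃ K ∈ 𝒦', (Prod.map π id ∘ untwist X S) ⁻¹' C =ᵐ[(m.prod S.μ).prod Measure.haar] K)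
    (h₂ : ∀ D ∈ 𝒦', MeasurableSet D ∧
      ∀ᵐ y ∂S.μ, ∃ K ∈ 𝒦, (fun z => (z, y)) ⁻¹' (twist X S ⁻¹' D) =ᵐ[m.prod Measure.haar] K) :
    Realizes ((m.prod S.μ).prod Measure.haar) 𝒦' (A.prod S) (Prod.map π id ∘ untwist X S) where
  classPreserving := (classPreserving_prodMap_id hA.classPreserving).comp classPreserving_untwist
  equivariant t := by
    have h1 : (Prod.map π id ∘ untwist X S) ∘ rightShift (X × S.Ω) t
        =ᵐ[(m.prod S.μ).prod Measure.haar]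
        (Prod.map π id ∘ Prod.map (rightShift X t) (S.act t)) ∘ untwist X S :=
      (untwist_comp_rightShift t).fun_comp (Prod.map π id)
    refine h1.trans (classPreserving_untwist.comp_ae_eq (b := (A.prod S).act t ∘ Prod.map π id) ?_)
    filter_upwards [Measure.quasiMeasurePreserving_fst.ae (hA.equivariant t)] with z hz
    exact Prod.ext hz rfl
  exists_mem := h₁
  exists_preimage D hD := by
    have : Nonempty X := nonempty_of_isProbabilityMeasure m
    obtain ⟨hDm, hsec⟩ := h₂ D hD
    obtain ⟨E, hE, e⟩ := exists_ae_eq_preimage_prodMap (ν := S.μ) hA.classPreserving.measurable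
      ((classPreserving_twist (m := m)).measurable hDm) (by
        filter_upwards [hsec] with y hy
        obtain ⟨K, hK, e⟩ := hy
        obtain ⟨C, hC, e'⟩ := hA.exists_preimage K hK
        exact ⟨C, hC, e.trans e'⟩)
    refine ⟨E, hE, EventuallyEq.trans ?_ (classPreserving_untwist.preimage_ae_eq e)⟩
    exact (twist_comp_untwist.preimage D).symm

theorem Realizes.prod_invariants [StandardBorelSpace X] [IsProbabilityMeasure m]
    (hT : IsNonsingular T m) (hf : Measurable f)
    (hA : Realizes (m.prod Measure.haar)
      {K | MeasurableSet[MeasurableSpace.invariants (skewProduct T f)] K} A π) :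
    Realizes ((m.prod S.μ).prod Measure.haar)
      {K | MeasurableSet[MeasurableSpace.invariants
        (skewProduct (rokhlin T f S) (fun z => f z.1))] K}
      (A.prod S) (Prod.map π id ∘ untwist X S) := by
  have hR := classPreserving_skewProduct hT hf
  have hR' := classPreserving_skewProduct (isNonsingular_rokhlin hT hf S)
    (hf.comp (measurable_fst (β := S.Ω)))
  have hu := classPreserving_untwist (m := m) (S := S)
  have hπ := hA.classPreserving.measurable
  refine hA.prod (fun C hC => ?_) fun D hD => ?_
  · have hm : Measurable (Prod.map π id ∘ untwist X S) :=
      (hπ.prodMap measurable_id).comp hu.measurable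
    have h1 := (untwist_comp_skewProduct (m := m) (S := S) (T := T) hf).fun_comp (Prod.map π id)
    have h2 : (Prod.map π id ∘ Prod.map (skewProduct T f) id)
        =ᵐ[(m.prod Measure.haar).prod S.μ] Prod.map π id := by
      filter_upwards [Measure.quasiMeasurePreserving_fst.ae
        (comp_ae_eq_self_of_sameModNull hR hA.exists_mem)] with z hz
      exact Prod.ext hz rfl
    have h3 := h1.trans (hu.comp_ae_eq h2)
    -- The pulled-back set is invariant only modulo null sets and is replaced by a strictly
    -- invariant one.
    obtain ⟨K, hK, e, hinv⟩ :=
      hR'.quasiMeasurePreserving.exists_preimage_eq_of_preimage_ae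
        (hm hC).nullMeasurableSet (h3.preimage C)
    exact ⟨K, MeasurableSpace.measurableSet_invariants.2 ⟨hK, hinv⟩, e.symm⟩
  · obtain ⟨hDm, hinv⟩ := MeasurableSpace.measurableSet_invariants.1 hD
    refine ⟨hDm, ?_⟩
    have h1 := (twist_comp_skewProduct (m := m) (S := S) (T := T) hf).preimage D
    rw [Set.preimage_comp, Set.preimage_comp, hinv] at h1
    filter_upwards [ae_section_ae_eq h1] with y hy
    obtain ⟨K, hK, e, hinv'⟩ := hR.quasiMeasurePreserving.exists_preimage_eq_of_preimage_ae
      (measurable_prodMk_right (classPreserving_twist (m := m).measurable hDm)).nullMeasurableSet hy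
    exact ⟨K, MeasurableSpace.measurableSet_invariants.2 ⟨hK, hinv'⟩, e.symm⟩

theorem Realizes.prod_tail [StandardBorelSpace X] [IsProbabilityMeasure m]
    (hT : IsNonsingular T m) (hf : Measurable f)
    (hA : Realizes (m.prod Measure.haar) {K | MeasurableSet[tailAlgebra (skewProduct T f)] K} A π) :
    Realizes ((m.prod S.μ).prod Measure.haar)
      {K | MeasurableSet[tailAlgebra (skewProduct (rokhlin T f S) (fun z => f z.1))] K}
      (A.prod S) (Prod.map π id ∘ untwist X S) := by
  have hX : Nonempty X := nonempty_of_isProbabilityMeasure m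
  have hΩ : Nonempty A.Ω := nonempty_of_isProbabilityMeasure A.μ
  have hR := classPreserving_skewProduct hT hf
  have hR' := classPreserving_skewProduct (isNonsingular_rokhlin hT hf S)
    (hf.comp (measurable_fst (β := S.Ω)))
  have hu := classPreserving_untwist (m := m) (S := S)
  have ht := classPreserving_twist (m := m) (S := S)
  have hπ := hA.classPreserving.measurable
  refine hA.prod (fun C hC => exists_tail_ae_eq hR' fun n => ?_) fun D hD =>
    ⟨tailAlgebra_le _ hD, ?_⟩
  -- In the tail case `π` need not be invariant, but for each `n` it is a function `σ` of the `n`-th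
  -- iterate.
  · obtain ⟨σ, hσ, e⟩ := exists_measurable_factor (m.prod Measure.haar) (hR.iterate n).measurable
      hπ fun E hE => by
        obtain ⟨K, hK, e⟩ := hA.exists_mem E hE
        obtain ⟨B, hB, rfl⟩ := measurableSet_tailAlgebra.1 hK n
        exact ⟨B, hB, e⟩
    have h1 := (ae_semiconj_iterate hR'
      (untwist_comp_skewProduct (m := m) (S := S) (T := T) hf) n).fun_comp (Prod.map σ id)
    have h2 : Prod.map π id =ᵐ[(m.prod Measure.haar).prod S.μ]
        Prod.map σ id ∘ (Prod.map (skewProduct T f) id)^[n] := by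
      rw [iterate_prodMap_id]
      filter_upwards [Measure.quasiMeasurePreserving_fst.ae e] with z hz
      exact Prod.ext hz rfl
    exact ⟨(Prod.map σ id ∘ untwist X S) ⁻¹' C,
      ((hσ.prodMap measurable_id).comp hu.measurable) hC,
      ((hu.comp_ae_eq h2).trans h1.symm).preimage C⟩
  · choose B hB hBD using measurableSet_tailAlgebra.1 hD
    have key : ∀ n, ∀ᵐ y ∂S.μ, (fun z => (z, y)) ⁻¹' (twist X S ⁻¹' D) =ᵐ[m.prod Measure.haar]
        (skewProduct T f)^[n] ⁻¹' ((fun z => (z, y)) ⁻¹' (twist X S ⁻¹' B n)) := by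
      intro n
      have h1 := (ae_semiconj_iterate (classPreserving_prodMap_id hR)
        (twist_comp_skewProduct (m := m) (S := S) (T := T) hf) n).preimage (B n)
      rw [Set.preimage_comp, Set.preimage_comp, hBD n, iterate_prodMap_id] at h1
      exact ae_section_ae_eq h1.symm
    -- One null set of `y` serves all `n`, so almost every section is tail modulo null sets.
    filter_upwards [ae_all_iff.2 key] with y hy
    exact exists_tail_ae_eq hR fun n =>
      ⟨_, measurable_prodMk_right (ht.measurable (hB n)), hy n⟩

/-! ### The one-point factor, for ergodic or exact `T_f`. -/

variable (G) in
/-- The trivial action on a point. -/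
noncomputable def NSAction.trivial : NSAction.{uG, 0} G where
  Ω := Unit
  μ := Measure.dirac ()
  act _ := id
  measurable_act := measurable_snd
  nonsingular _ := ClassPreserving.id.isNonsingular
  act_one := ae_eq_rfl
  act_mul _ _ := ae_eq_rfl

theorem realizes_trivial {η : Measure (X × G)} (hη : η ≠ 0) (hempty : ∅ ∈ 𝒦)
    (huniv : Set.univ ∈ 𝒦) (h : ∀ K ∈ 𝒦, η K = 0 ∨ η Kᶜ = 0) :
    Realizes η 𝒦 (NSAction.trivial G) (fun _ => ()) where
  classPreserving := ⟨measurable_const, fun E _ => by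
    rcases Subsingleton.set_cases (p := fun E : Set Unit => E = ∅ ∨ E = Set.univ)
      (Or.inl rfl) (Or.inr rfl) E with rfl | rfl
    · change η ∅ = 0 ↔ (NSAction.trivial G).μ ∅ = 0
      simp
    · change η Set.univ = 0 ↔ (NSAction.trivial G).μ Set.univ = 0
      simp [hη]⟩
  equivariant _ := ae_eq_rfl
  exists_mem E _ := by
    rcases Subsingleton.set_cases (p := fun E : Set Unit => E = ∅ ∨ E = Set.univ)
      (Or.inl rfl) (Or.inr rfl) E with rfl | rfl
    · exact ⟨∅, hempty, ae_eq_rfl⟩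
    · exact ⟨Set.univ, huniv, ae_eq_rfl⟩
  exists_preimage K hK := by
    rcases h K hK with h | h
    · exact ⟨∅, .empty, ae_eq_empty.2 h⟩
    · exact ⟨Set.univ, .univ, ae_eq_univ.2 h⟩

/-- A point times `S` is `S`; this makes the last two claims instances of the product formulas. -/
theorem Realizes.of_trivial_prod {η : Measure (X × G)}
    {σ : X × G → ((NSAction.trivial G).prod S).Ω}
    (h : Realizes η 𝒦 ((NSAction.trivial G).prod S) σ) :
    Realizes η 𝒦 S (fun z => (σ z).2) where
  classPreserving := by
    refine ClassPreserving.comp (S := Prod.snd) ?_ h.classPreserving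
    exact (measurePreserving_snd (μ := (NSAction.trivial G).μ) (ν := S.μ)).classPreserving
  equivariant t := (h.equivariant t).fun_comp Prod.snd
  exists_mem E hE := h.exists_mem (Prod.snd ⁻¹' E) (measurable_snd hE)
  exists_preimage K hK := by
    obtain ⟨E, hE, e⟩ := h.exists_preimage K hK
    exact ⟨(fun y => ((), y)) ⁻¹' E, measurable_prodMk_left hE, e⟩

end Product

/-! ### The main theorem. -/

theorem proposition2p1
    {G : Type uG} [Group G] [TopologicalSpace G] [IsTopologicalGroup G]
    [LocallyCompactSpace G] [PolishSpace G] [MeasurableSpace G] [BorelSpace G]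
    {X : Type uX} [MeasurableSpace X] [StandardBorelSpace X]
    (m : Measure X) [IsProbabilityMeasure m]
    (T : X → X) (hT : IsNonsingular T m)
    (f : X → G) (hf : Measurable f)
    (S : NSAction.{uG, uY} G) :
    -- the Rokhlin map is a non-singular endomorphism
    IsNonsingular (rokhlin T f S) (m.prod S.μ) ∧
    -- the associated actions exist
    (∃ A : NSAction.{uG, 0} G, IsInvariantAction m T f A) ∧
    (∃ A : NSAction.{uG, 0} G, IsTailAction m T f A) ∧
    (∃ B : NSAction.{uG, 0} G,
      IsInvariantAction (m.prod S.μ) (rokhlin T f S) (fun z => f z.1) B) ∧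
    (∃ B : NSAction.{uG, 0} G,
      IsTailAction (m.prod S.μ) (rokhlin T f S) (fun z => f z.1) B) ∧
    -- `𝔭(T̃, f) ≅ 𝔭(T, f) × S`
    (∀ (A : NSAction.{uG, uA} G) (B : NSAction.{uG, uB} G),
      IsInvariantAction m T f A →
      IsInvariantAction (m.prod S.μ) (rokhlin T f S) (fun z => f z.1) B →
      B.Isomorphic (A.prod S)) ∧
    -- `τ(T̃, f) ≅ τ(T, f) × S`
    (∀ (A : NSAction.{uG, uA} G) (B : NSAction.{uG, uB} G),
      IsTailAction m T f A →
      IsTailAction (m.prod S.μ) (rokhlin T f S) (fun z => f z.1) B →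
      B.Isomorphic (A.prod S)) ∧
    -- `T̃` is ergodic iff `𝔭(T, f) × S` is
    (∀ A : NSAction.{uG, uA} G, IsInvariantAction m T f A →
      (QuasiErgodic (rokhlin T f S) (m.prod S.μ) ↔ (A.prod S).IsErgodic)) ∧
    -- `T̃` is exact iff `τ(T, f) × S` is ergodic
    (∀ A : NSAction.{uG, uA} G, IsTailAction m T f A →
      (IsExact (rokhlin T f S) (m.prod S.μ) ↔ (A.prod S).IsErgodic)) ∧
    -- if `T_f` and `S` are ergodic, then `T̃` is ergodic and `𝔭(T̃, f) ≅ S`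
    (QuasiErgodic (skewProduct T f) (m.prod Measure.haar) → S.IsErgodic →
      QuasiErgodic (rokhlin T f S) (m.prod S.μ) ∧
      ∀ B : NSAction.{uG, uB} G,
        IsInvariantAction (m.prod S.μ) (rokhlin T f S) (fun z => f z.1) B →
        B.Isomorphic S) ∧
    -- if `T_f` is exact and `S` is ergodic, then `T̃` is exact and `τ(T̃, f) ≅ S`
    (IsExact (skewProduct T f) (m.prod Measure.haar) → S.IsErgodic →
      IsExact (rokhlin T f S) (m.prod S.μ) ∧
      ∀ B : NSAction.{uG, uB} G,
        IsTailAction (m.prod S.μ) (rokhlin T f S) (fun z => f z.1) B →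
        B.Isomorphic S) := by
  have hf' : Measurable fun z : X × S.Ω => f z.1 := hf.comp measurable_fst
  have hT' : IsNonsingular (rokhlin T f S) (m.prod S.μ) := isNonsingular_rokhlin hT hf S
  have hη : m.prod (Measure.haar (G := G)) ≠ 0 := by
    rw [Ne, ← Measure.measure_univ_eq_zero, ← Set.univ_prod_univ, Measure.prod_prod]
    simpa using NeZero.ne (Measure.haar (G := G))
  refine ⟨hT', exists_isInvariantAction hT hf, exists_isTailAction T f,
    exists_isInvariantAction hT' hf', exists_isTailAction _ _, ?_, ?_, ?_, ?_, ?_, ?_⟩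
  · intro A B hA hB
    obtain ⟨π, hπ⟩ := hA.exists_realizes
    obtain ⟨σ, hσ⟩ := hB.exists_realizes
    exact hσ.isomorphic classPreserving_rightShift (hπ.prod_invariants hT hf)
  · intro A B hA hB
    obtain ⟨π, hπ⟩ := hA.exists_realizes
    obtain ⟨σ, hσ⟩ := hB.exists_realizes
    exact hσ.isomorphic classPreserving_rightShift (hπ.prod_tail hT hf)
  · intro A hA
    obtain ⟨π, hπ⟩ := hA.exists_realizes
    rw [(hπ.prod_invariants hT hf).isErgodic_iff, quasiErgodic_iff_invariants hT' hf']
  · intro A hA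
    obtain ⟨π, hπ⟩ := hA.exists_realizes
    rw [(hπ.prod_tail hT hf).isErgodic_iff, isExact_iff_tail hT' hf']
  · intro herg hS
    have htriv := realizes_trivial hη
      (𝒦 := {K | MeasurableSet[MeasurableSpace.invariants (skewProduct T f)] K})
      (@MeasurableSet.empty _ (MeasurableSpace.invariants (skewProduct T f)))
      (@MeasurableSet.univ _ (MeasurableSpace.invariants (skewProduct T f))) fun K hK => by
        obtain ⟨hKm, hinv⟩ := MeasurableSpace.measurableSet_invariants.1 hK
        exact (eventuallyConst_set'.1 (herg.aeconst_set hKm hinv)).imp ae_eq_empty.1 ae_eq_univ.1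
    have hreal := (htriv.prod_invariants (S := S) hT hf).of_trivial_prod
    -- `S` itself realizes the invariant factor over `T̃`, so its ergodicity gives that of `T̃`, and
    -- uniqueness gives the isomorphism.
    refine ⟨(quasiErgodic_iff_invariants hT' hf').2 (hreal.isErgodic_iff.1 hS), fun B hB => ?_⟩
    obtain ⟨σ, hσ⟩ := hB.exists_realizes
    exact hσ.isomorphic classPreserving_rightShift hreal
  · intro hex hS
    have htriv := realizes_trivial hη
      (𝒦 := {K | MeasurableSet[tailAlgebra (skewProduct T f)] K})
      (@MeasurableSet.empty _ (tailAlgebra (skewProduct T f)))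
      (@MeasurableSet.univ _ (tailAlgebra (skewProduct T f))) hex
    have hreal := (htriv.prod_tail (S := S) hT hf).of_trivial_prod
    refine ⟨(isExact_iff_tail hT' hf').2 (hreal.isErgodic_iff.1 hS), fun B hB => ?_⟩
    obtain ⟨σ, hσ⟩ := hB.exists_realizes
    exact hσ.isomorphic classPreserving_rightShift hreal
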